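/- Let $f(z)=\sum_{k=0}^\infty a_k z^k$ be an entire function with $a_k>0$ for all $k\ge 0$, and let $q_n=\dfrac{a_{n-1}^2}{a_{n-2}a_n}$ for $n\ge 2$. Suppose that for some real numbers $1<a<b$ we have $q_{2m}=a$ and $q_{2m+1}=b$ for all integers $m\ge 1$. Then $f$ belongs to the Laguerre–Pólya class of type I if and only if there exists a real $z_0\in\left[-\dfrac{a_1}{a_2},0\right]$ with $f(z_0)\le 0$. Here a real entire function $g$ is in the Laguerre–Pólya class of type I if it can be written as $g(z)=c\,z^n e^{\beta z}\prod_{k}\left(1+\dfrac{z}{x_k}\right)$, where $c\in\mathbb{R}$, $\beta\ge 0$, $n$ is a nonnegative integer, $x_k>0$, $\sum_k x_k^{-1}<\infty$, and the product is infinite, finite or empty (an empty product being equal to $1$). -/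

import Mathlib

open scoped ComplexOrder

/-- A real entire function: holomorphic on the whole complex plane and real on the real axis. -/
def IsRealEntire (f : ℂ → ℂ) : Prop :=
  Differentiable ℂ f ∧ ∀ x : ℝ, (f (x : ℂ)).im = 0

/-- The Laguerre–Pólya class of type I: real entire functions of the form
`f(z) = c z^n e^{β z} ∏_k (1 + z / x_k)` with `c ∈ ℝ`, `β ≥ 0`, `n` a nonnegative integer,
`x_k > 0` and `∑_k 1 / x_k < ∞`. The product may be infinite, finite or empty: its factors are
indexed by a set `S` of natural numbers. Summability of `1 / x_k` makes the product converge
absolutely for every `z`. -/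
def LaguerrePolyaI (f : ℂ → ℂ) : Prop :=
  IsRealEntire f ∧
    ∃ (c β : ℝ) (n : ℕ) (S : Set ℕ) (x : S → ℝ),
      0 ≤ β ∧ (∀ k, 0 < x k) ∧ Summable (fun k => 1 / x k) ∧
        ∀ z : ℂ, f z = (c : ℂ) * z ^ n * Complex.exp ((β : ℂ) * z) *
          ∏' k, (1 + z / (x k : ℂ))

/-- The second quotients `q_n = a_{n-1}^2 / (a_{n-2} a_n)` of a sequence of (nonzero) Taylor
coefficients; only meaningful for `n ≥ 2`. -/
noncomputable def secondQuotient (a : ℕ → ℝ) (n : ℕ) : ℝ :=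
  a (n - 1) ^ 2 / (a (n - 2) * a n)

/-! Rescale `f` to F with `c 0 = c 1 = 1` and put Q = ab. Then F(Qz) = 1 + Qz + (Qz)² F(z)/a, and
the interval becomes [-a, 0].

Sufficiency: for 0 < x < Q the odd sections at -x increase strictly to F(-x), so F(-x) ≤ 0 makes all
of them negative at x. The first two then force x > 1 and a > 3. The functional equation carries the
negative sign to Q^i x, and positivity at a√b to Q^i a√b, as far as the degree permits. Together
with positivity at 1, this gives the section of degree 2m+1 at least 2m-1 zeros, separated by points
independent of m (`exists_oddSection_roots`). It is therefore 1 + αz + γz² times controlled linear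
factors, and γ → 0 (`exists_section_factorization`). A subsequential limit writes F as a convergent
product of linear factors (`exists_eq_tprod_of_oddSection_neg`).

Necessity: only q₂ and q₃ matter. Let y_k = 1/x_k, with power sums p_j, and let g be the ratio of
the first two coefficients. Comparing logarithms to third order determines p₂ and p₃ and gives p₁ ≤
g (`power_sums_of_eq_exp_mul_tprod`). If every y_k were at most g/a, then p₃ ≤ (g/a) p₂, which is
incompatible with the Cauchy–Schwarz bound p₂² ≤ p₁ p₃ (`exists_le_of_power_sums`). So an actual
zero of `f` lies in the interval. -/

/-- Normalised Taylor coefficients (`c 0 = c 1 = 1`) whose second quotients are alternately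
`a` and `b`. -/
structure IsAlternatingQuotient (c : ℕ → ℝ) (a b : ℝ) : Prop where
  zero : c 0 = 1
  one : c 1 = 1
  step : ∀ k, c (k + 2) = c k / (a * (a * b) ^ k)

/-- The section of degree `2 * m + 1` of `∑ c k * z ^ k`, evaluated at `-x`. -/
noncomputable def oddSection (c : ℕ → ℝ) (m : ℕ) (x : ℝ) : ℝ :=
  ∑ k ∈ Finset.range (2 * m + 2), c k * (-x) ^ k

/-! ### Odd sections: functional equation and monotonicity. -/

namespace IsAlternatingQuotient

variable {c : ℕ → ℝ} {a b : ℝ}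

theorem pos (h : IsAlternatingQuotient c a b) (ha : 0 < a) (hb : 0 < b) (k : ℕ) : 0 < c k := by
  induction k using Nat.twoStepInduction with
  | zero => simp [h.zero]
  | one => simp [h.one]
  | more k ih _ => rw [h.step]; positivity

theorem ratio_even (h : IsAlternatingQuotient c a b) (ha : 0 < a) (hb : 0 < b) (m : ℕ) :
    c (2 * m) = (a * b) ^ m * c (2 * m + 1) := by
  induction m with
  | zero => simp [h.zero, h.one]
  | succ m ih =>
    have e1 := h.step (2 * m)
    have e2 := h.step (2 * m + 1)
    rw [show 2 * (m + 1) = 2 * m + 2 by ring, show 2 * m + 2 + 1 = 2 * m + 1 + 2 by ring, e1, e2, ih]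
    field_simp
    ring

theorem ratio_odd (h : IsAlternatingQuotient c a b) (ha : 0 < a) (hb : 0 < b) (m : ℕ) :
    c (2 * m + 1) = a * (a * b) ^ m * c (2 * m + 2) := by
  rw [h.step (2 * m), h.ratio_even ha hb m]
  field_simp
  ring

theorem oddSection_zero (h : IsAlternatingQuotient c a b) (x : ℝ) : oddSection c 0 x = 1 - x := by
  simp [oddSection, Finset.sum_range_succ, h.zero, h.one]; ring

/-- The functional equation of F, truncated: multiplying the argument by ab raises the degree of the
section by two. -/
theorem oddSection_succ_scale (h : IsAlternatingQuotient c a b) (ha : 0 < a) (hb : 0 < b)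
    (m : ℕ) (x : ℝ) :
    oddSection c (m + 1) (a * b * x) =
      1 - a * b * x + (a * b * x) ^ 2 / a * oddSection c m x := by
  have key : ∀ k, c (k + 2) * (-(a * b * x)) ^ (k + 2) =
      (a * b * x) ^ 2 / a * (c k * (-x) ^ k) := by
    intro k
    rw [h.step, show -(a * b * x) = a * b * (-x) by ring]
    field_simp
    ring
  unfold oddSection
  rw [show 2 * (m + 1) + 2 = 2 * m + 2 + 1 + 1 by ring, Finset.sum_range_succ',
    Finset.sum_range_succ', Finset.sum_congr rfl fun k _ => key k, ← Finset.mul_sum]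
  simp [h.zero, h.one]
  ring

theorem oddSection_succ (h : IsAlternatingQuotient c a b) (ha : 0 < a) (hb : 0 < b)
    (m : ℕ) (x : ℝ) :
    oddSection c (m + 1) x = oddSection c m x +
      c (2 * m + 3) * x ^ (2 * m + 2) * ((a * b) ^ (m + 1) - x) := by
  have e := h.ratio_even ha hb (m + 1)
  rw [show 2 * (m + 1) = 2 * m + 2 by ring, show 2 * m + 2 + 1 = 2 * m + 3 by ring] at e
  have p1 : (-x) ^ (2 * m + 2) = x ^ (2 * m + 2) := Even.neg_pow ⟨m + 1, by ring⟩ x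
  have p2 : (-x) ^ (2 * m + 3) = -x ^ (2 * m + 3) := Odd.neg_pow ⟨m + 1, by ring⟩ x
  unfold oddSection
  rw [show 2 * (m + 1) + 2 = 2 * m + 2 + 1 + 1 by ring, Finset.sum_range_succ,
    Finset.sum_range_succ, show 2 * m + 2 + 1 = 2 * m + 3 by ring, p1, p2, e]
  ring

theorem strictMono_oddSection (h : IsAlternatingQuotient c a b) (ha : 1 < a) (hb : 1 < b)
    {x : ℝ} (hx : 0 < x) (hxQ : x < a * b) : StrictMono fun m => oddSection c m x := by
  refine strictMono_nat_of_lt_succ fun m => ?_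
  have ha0 : 0 < a := by linarith
  have hb0 : 0 < b := by linarith
  have hc := h.pos ha0 hb0 (2 * m + 3)
  have hQ : 1 ≤ a * b := by nlinarith
  have hlt : x < (a * b) ^ (m + 1) := hxQ.trans_le (le_self_pow₀ hQ (by simp))
  have : 0 < c (2 * m + 3) * x ^ (2 * m + 2) * ((a * b) ^ (m + 1) - x) := by
    have := sub_pos.2 hlt
    positivity
  rw [h.oddSection_succ ha0 hb0]
  linarith

theorem oddSection_lt_of_hasSum (h : IsAlternatingQuotient c a b) (ha : 1 < a) (hb : 1 < b)
    {x s : ℝ} (hx : 0 < x) (hxQ : x < a * b) (hs : HasSum (fun k => c k * (-x) ^ k) s) (m : ℕ) :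
    oddSection c m x < s := by
  have hmono := h.strictMono_oddSection ha hb hx hxQ
  have ht : Filter.Tendsto (fun m => oddSection c m x) Filter.atTop (nhds s) :=
    hs.tendsto_sum_nat.comp
      (Filter.tendsto_atTop_mono (fun n => by omega : ∀ n : ℕ, n ≤ 2 * n + 2) Filter.tendsto_id)
  exact (hmono m.lt_succ_self).trans_le (hmono.monotone.ge_of_tendsto ht _)

theorem oddSection_one (h : IsAlternatingQuotient c a b) (ha : 0 < a) (hb : 0 < b) (x : ℝ) :
    oddSection c 1 x = 1 - x + x ^ 2 / a - x ^ 3 / (a ^ 2 * b) := by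
  have h2 := h.step 0
  have h3 := h.step 1
  simp only [zero_add, h.zero, h.one] at h2 h3
  simp only [oddSection, Finset.sum_range_succ, Finset.sum_range_zero, h.zero, h.one, h2, h3]
  field_simp
  ring

/-! ### Signs of the low sections on `[0, a]` and at a√b. -/

/-- A non-positive value on `[0, a]` forces `a` to exceed `3`. -/
theorem three_lt_of_oddSection_neg (h : IsAlternatingQuotient c a b) (ha : 1 < a) (hab : a < b)
    {x : ℝ} (hx0 : 0 < x) (hxa : x ≤ a) (hx : oddSection c 1 x < 0) : 3 < a := by
  rw [h.oddSection_one (by linarith) (by linarith)] at hx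
  by_contra! h3
  have ha0 : 0 < a := by linarith
  obtain ⟨s, rfl⟩ : ∃ s, x = a * s := ⟨x / a, by field_simp⟩
  have hs0 : 0 < s := pos_of_mul_pos_right hx0 ha0.le
  have hs1 : s ≤ 1 := by nlinarith
  have e : 1 - a * s + (a * s) ^ 2 / a - (a * s) ^ 3 / (a ^ 2 * b) =
      1 - a * s + a * s ^ 2 - a / b * s ^ 3 := by
    have : b ≠ 0 := by linarith
    field_simp
  rw [e] at hx
  have hab' : a / b * s ^ 3 ≤ 1 * s ^ 3 := by
    gcongr
    rw [div_le_one (by linarith)]; exact hab.le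
  -- The product is 1 - as + as² - s³, the cubic with a/b replaced by 1. For a ≤ 3 its second factor
  -- is at least (1 - s)².
  have : 0 ≤ (1 - s) * (1 + s + s ^ 2 - a * s) :=
    mul_nonneg (by linarith) (by nlinarith [sq_nonneg (s - 1)])
  nlinarith

/-- Writing the odd-index quotient as b² avoids square roots: the point a√q₃ is `a * b`. There the
terms of index 0 to 4 have the symmetric moduli 1, ab, ab², ab, 1. -/
theorem oddSection_two_sqrt (h : IsAlternatingQuotient c a (b ^ 2)) (ha : 0 < a) (hb : 0 < b) :
    oddSection c 2 (a * b) = 2 + a * b ^ 2 - 2 * (a * b) - 1 / (a * b ^ 3) := by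
  have h2 := h.step 0
  have h3 := h.step 1
  have h4 := h.step 2
  have h5 := h.step 3
  simp only [zero_add, Nat.reduceAdd, h.zero, h.one] at h2 h3 h4 h5
  rw [h2] at h4
  rw [h3] at h5
  simp only [oddSection, Finset.sum_range_succ, Finset.sum_range_zero, h.zero, h.one, h2, h3, h4,
    h5]
  field_simp
  ring

theorem le_oddSection_two_sqrt (h : IsAlternatingQuotient c a (b ^ 2)) (ha : 3 < a) (hb : 1 < b)
    (hab : a < b ^ 2) : 1 / (a * b ^ 3) ≤ oddSection c 2 (a * b) := by
  rw [h.oddSection_two_sqrt (by linarith) (by linarith)]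
  have hb3 : 1 ≤ b ^ 3 := one_le_pow₀ hb.le
  have h1 : 1 / (a * b ^ 3) ≤ 1 / 9 := by
    apply one_div_le_one_div_of_le (by norm_num)
    nlinarith
  -- When b < 2, the bound a < b² leads to b³(2 - b), whose maximum 27/16 is attained at b = 3/2.
  -- The claim follows since 27/16 + 2/9 < 2.
  have h2 : a * b * (2 - b) ≤ 27 / 16 := by
    rcases le_total 2 b with h | h
    · nlinarith [mul_nonneg (mul_pos (by linarith : 0 < a) (by linarith : 0 < b)).le
        (sub_nonneg.2 h)]
    · have : a * (b * (2 - b)) ≤ b ^ 2 * (b * (2 - b)) := by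
        gcongr
      nlinarith [mul_nonneg (sq_nonneg (2 * b - 3)) (by nlinarith [sq_nonneg (b + 1/2)] :
        0 ≤ 4 * b ^ 2 + 4 * b + 3)]
  nlinarith

end IsAlternatingQuotient

/-! ### Separating points. -/

/-- The points `1, x, y, Q x, Q y, Q² x, Q² y, …` at which the sections change sign. -/
noncomputable def samplePoint (Q x y : ℝ) : ℕ → ℝ
  | 0 => 1
  | 1 => x
  | 2 => y
  | k + 3 => Q * samplePoint Q x y (k + 1)

section SamplePoint

variable {Q x y : ℝ}

theorem samplePoint_odd (i : ℕ) : samplePoint Q x y (2 * i + 1) = Q ^ i * x := by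
  induction i with
  | zero => simp [samplePoint]
  | succ i ih =>
    rw [show 2 * (i + 1) + 1 = 2 * i + 3 by ring, samplePoint, ih]; ring

theorem samplePoint_even (i : ℕ) : samplePoint Q x y (2 * i + 2) = Q ^ i * y := by
  induction i with
  | zero => simp [samplePoint]
  | succ i ih =>
    rw [show 2 * (i + 1) + 2 = 2 * i + 1 + 3 by ring, samplePoint, ih]; ring

theorem strictMono_samplePoint (hQ : 0 < Q) (hx : 1 < x) (hxy : x < y) (hy : y < Q * x) :
    StrictMono (samplePoint Q x y) := by
  refine strictMono_nat_of_lt_succ fun k => ?_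
  match k with
  | 0 => simpa [samplePoint] using hx
  | k + 1 =>
    obtain ⟨i, rfl | rfl⟩ := Nat.even_or_odd' k
    · rw [show 2 * i + 1 + 1 = 2 * i + 2 by ring, samplePoint_odd, samplePoint_even]
      gcongr
    · rw [show 2 * i + 1 + 1 = 2 * i + 2 by ring, show 2 * i + 2 + 1 = 2 * (i + 1) + 1 by ring,
        samplePoint_odd, samplePoint_even, pow_succ, mul_assoc]
      gcongr

/-- Bounds the reciprocals of the zeros by a geometric series independent of the degree, as
dominated convergence will require. -/
theorem le_samplePoint (hQ : 9 ≤ Q) (hx : 1 ≤ x) (hy : 1 ≤ y) (k : ℕ) :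
    3 ^ k / 9 ≤ samplePoint Q x y k := by
  have aux : ∀ i : ℕ, (9 : ℝ) ^ i ≤ Q ^ i := fun i => by gcongr
  match k with
  | 0 => norm_num [samplePoint]
  | k + 1 =>
    obtain ⟨i, rfl | rfl⟩ := Nat.even_or_odd' k
    · rw [samplePoint_odd, pow_succ, pow_mul]
      norm_num
      nlinarith [aux i, pow_pos (by norm_num : (0 : ℝ) < 9) i]
    · rw [show 2 * i + 1 + 1 = 2 * i + 2 by ring, samplePoint_even, pow_add, pow_mul]
      norm_num
      nlinarith [aux i, pow_pos (by norm_num : (0 : ℝ) < 9) i]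

end SamplePoint

/-! ### Sign alternation and real zeros of the odd sections. -/

namespace IsAlternatingQuotient

variable {c : ℕ → ℝ} {a b x : ℝ}

/-- Each zero lies below the next separating point, so this supplies the hypothesis of `prod_mul_le`
and thereby the bound on γ. -/
theorem mul_samplePoint_le (h : IsAlternatingQuotient c a b) (ha : 0 < a) (hb : 0 < b) {y : ℝ}
    (hx : x ≤ a) (hy : y ≤ a * b) (k : ℕ) :
    c (k + 2) * samplePoint (a * b) x y (k + 1) ≤ c (k + 1) := by
  have hc := (h.pos ha hb (k + 2)).le
  obtain ⟨i, rfl | rfl⟩ := Nat.even_or_odd' k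
  · rw [samplePoint_odd, h.ratio_odd ha hb, mul_comm, mul_comm a ((a * b) ^ i)]
    exact mul_le_mul_of_nonneg_right (by gcongr) hc
  · have e := h.ratio_even ha hb (i + 1)
    rw [show 2 * (i + 1) = 2 * i + 2 by ring] at e
    rw [show 2 * i + 1 + 1 = 2 * i + 2 by ring, samplePoint_even, e, pow_succ, mul_comm]
    exact mul_le_mul_of_nonneg_right (by gcongr) hc

/-- In `oddSection_succ_scale` the linear part is also negative, since the rescaled point exceeds 1.
Each rescaling uses up one step of the degree, hence i ≤ m. -/
theorem oddSection_scale_neg (h : IsAlternatingQuotient c a b) (ha : 1 < a) (hb : 1 < b)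
    (hx : 1 < x) (hneg : ∀ m, oddSection c m x < 0) (i : ℕ) :
    ∀ m, i ≤ m → oddSection c m ((a * b) ^ i * x) < 0 := by
  induction i with
  | zero => simpa using hneg
  | succ i ih =>
    intro m hm
    obtain ⟨m, rfl⟩ : ∃ n, m = n + 1 := ⟨m - 1, by omega⟩
    have hQ : 1 ≤ a * b := by nlinarith
    rw [show (a * b) ^ (i + 1) * x = a * b * ((a * b) ^ i * x) by ring,
      h.oddSection_succ_scale (by linarith) (by linarith)]
    have h1 := ih m (by omega)
    have h2 : 1 < a * b * ((a * b) ^ i * x) := by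
      have := one_le_pow₀ hQ (n := i)
      have h3 : 1 < (a * b) ^ i * x := by nlinarith
      nlinarith
    have h3 : 0 < (a * b * ((a * b) ^ i * x)) ^ 2 / a := by
      have : 0 < a := by linarith
      positivity
    nlinarith

/-- Mere positivity would not propagate past the negative term -QY. The threshold 1/(ab³) does: it
turns the quadratic term into at least bY², which dominates QY = ab²Y because Y ≥ ab. What remains
is at least 1. -/
theorem oddSection_scale_pos (h : IsAlternatingQuotient c a (b ^ 2)) (ha : 3 < a) (hb : 1 < b)
    (hab : a < b ^ 2) (i : ℕ) :
    ∀ m, i + 2 ≤ m → 1 / (a * b ^ 3) ≤ oddSection c m ((a * b ^ 2) ^ i * (a * b)) := by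
  have ha0 : 0 < a := by linarith
  have hb0 : 0 < b := by linarith
  induction i with
  | zero =>
    intro m hm
    have hmono := (h.strictMono_oddSection (x := a * b) (by linarith) (by nlinarith)
      (by positivity) (by nlinarith [mul_pos ha0 hb0])).monotone hm
    simpa using (h.le_oddSection_two_sqrt ha hb hab).trans hmono
  | succ i ih =>
    intro m hm
    obtain ⟨m, rfl⟩ : ∃ n, m = n + 1 := ⟨m - 1, by omega⟩
    have hb2 : 1 ≤ b ^ 2 := one_le_pow₀ hb.le
    have hQ : 1 ≤ a * b ^ 2 := by nlinarith
    rw [show (a * b ^ 2) ^ (i + 1) * (a * b) = a * b ^ 2 * ((a * b ^ 2) ^ i * (a * b)) by ring,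
      h.oddSection_succ_scale (by linarith) (by linarith)]
    have h1 := ih m (by omega)
    set Y := (a * b ^ 2) ^ i * (a * b) with hY
    have hYge : a * b ≤ Y := le_mul_of_one_le_left (by positivity) (one_le_pow₀ hQ)
    have hY0 : 0 < Y := by positivity
    have h2 : a * b ^ 2 * Y ≤ (a * b ^ 2 * Y) ^ 2 / a * (1 / (a * b ^ 3)) := by
      have : (a * b ^ 2 * Y) ^ 2 / a * (1 / (a * b ^ 3)) = b * Y * Y := by
        field_simp
      rw [this]
      nlinarith [mul_pos hb0 hY0]
    have h3 : (a * b ^ 2 * Y) ^ 2 / a * (1 / (a * b ^ 3)) ≤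
        (a * b ^ 2 * Y) ^ 2 / a * oddSection c m Y := by gcongr
    have h4 : 1 / (a * b ^ 3) ≤ 1 := by
      rw [div_le_one (by positivity)]
      nlinarith [one_le_pow₀ hb.le (n := 3)]
    linarith

theorem oddSection_one_pos (h : IsAlternatingQuotient c a b) (ha : 1 < a) (hb : 1 < b) {m : ℕ}
    (hm : 1 ≤ m) : 0 < oddSection c m 1 := by
  have := h.strictMono_oddSection ha hb one_pos (by nlinarith) (show 0 < m by omega)
  simpa [h.oddSection_zero] using this

theorem oddSection_samplePoint_sign (h : IsAlternatingQuotient c a (b ^ 2)) (ha : 3 < a)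
    (hb : 1 < b) (hab : a < b ^ 2) (hx : 1 < x) (hneg : ∀ m, oddSection c m x < 0) {m k : ℕ}
    (hk : k < 2 * m) :
    0 < (-1) ^ k * oddSection c m (samplePoint (a * b ^ 2) x (a * b) k) := by
  match k with
  | 0 => simpa [samplePoint] using h.oddSection_one_pos (by linarith) (by linarith) (by omega)
  | k + 1 =>
    obtain ⟨i, rfl | rfl⟩ := Nat.even_or_odd' k
    · have := h.oddSection_scale_neg (by linarith) (by linarith) hx hneg i m (by omega)
      rw [samplePoint_odd, pow_succ, pow_mul]
      simpa using this
    · have := h.oddSection_scale_pos ha hb hab i m (by omega)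
      rw [show 2 * i + 1 + 1 = 2 * i + 2 by ring, samplePoint_even, pow_add, pow_mul]
      have h0 : 0 < 1 / (a * b ^ 3) := by positivity
      simpa using h0.trans_le this

theorem continuous_oddSection (c : ℕ → ℝ) (m : ℕ) : Continuous (oddSection c m) := by
  unfold oddSection
  fun_prop

/-- Intermediate values between 2m points of alternating sign. The degree is 2m+1, so exactly two
zeros stay uncontrolled. -/
theorem exists_oddSection_roots (h : IsAlternatingQuotient c a (b ^ 2)) (ha : 3 < a)
    (hb : 1 < b) (hab : a < b ^ 2) (hx : 1 < x) (hneg : ∀ m, oddSection c m x < 0)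
    (hmono : StrictMono (samplePoint (a * b ^ 2) x (a * b))) (m : ℕ) :
    ∃ z : ℕ → ℝ, ∀ k < 2 * m - 1, oddSection c m (z k) = 0 ∧
      samplePoint (a * b ^ 2) x (a * b) k < z k ∧ z k < samplePoint (a * b ^ 2) x (a * b) (k + 1) := by
  have key : ∀ k, ∃ z, k < 2 * m - 1 → oddSection c m z = 0 ∧
      samplePoint (a * b ^ 2) x (a * b) k < z ∧ z < samplePoint (a * b ^ 2) x (a * b) (k + 1) := by
    intro k
    by_cases hk : k < 2 * m - 1
    · have s1 := h.oddSection_samplePoint_sign ha hb hab hx hneg (show k < 2 * m by omega)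
      have s2 := h.oddSection_samplePoint_sign ha hb hab hx hneg (show k + 1 < 2 * m by omega)
      have hcont : Continuous fun t => (-1) ^ k * oddSection c m t :=
        continuous_const.mul (continuous_oddSection c m)
      obtain ⟨z, hz, hz0⟩ := intermediate_value_Ioo' (hmono k.lt_succ_self).le hcont.continuousOn
        (show (0 : ℝ) ∈ _ from ⟨by rw [pow_succ] at s2; simpa using s2, s1⟩)
      refine ⟨z, fun _ => ⟨?_, hz.1, hz.2⟩⟩
      simpa using hz0
    · exact ⟨0, fun h => absurd h hk⟩
  exact ⟨fun k => (key k).choose, fun k => (key k).choose_spec⟩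

end IsAlternatingQuotient

/-! ### Factorisation of the sections. -/

open Polynomial in
/-- A polynomial with constant term `1` of degree at most `N + 2` with `N` distinct prescribed
roots `-z k` splits off the corresponding linear factors. -/
theorem Polynomial.exists_eq_quadratic_mul_prod {p : ℝ[X]} {N : ℕ} {z : ℕ → ℝ}
    (hdeg : p.natDegree ≤ N + 2) (hp : p.coeff 0 = 1) (hz : ∀ k < N, 0 < z k)
    (hinj : Set.InjOn z (Finset.range N)) (hroot : ∀ k < N, p.eval (-z k) = 0) :
    ∃ α : ℝ, p = (1 + C α * X + C (p.coeff (N + 2) * ∏ k ∈ Finset.range N, z k) * X ^ 2) *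
      ∏ k ∈ Finset.range N, (1 + C (1 / z k) * X) := by
  set D : ℝ[X] := ∏ k ∈ Finset.range N, (X - C (-z k)) with hD
  have hdvd : D ∣ p := by
    refine Finset.prod_dvd_of_coprime (fun i hi j hj hij => ?_) fun k hk => ?_
    · refine isCoprime_X_sub_C_of_isUnit_sub (sub_ne_zero_of_ne fun e => hij ?_).isUnit
      exact hinj hi hj (neg_injective e)
    · exact dvd_iff_isRoot.2 (hroot k (Finset.mem_range.1 hk))
  obtain ⟨q, hq⟩ := hdvd
  have hDmonic : D.Monic := monic_prod_of_monic _ _ fun k _ => monic_X_sub_C _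
  have hDdeg : D.natDegree = N := by
    rw [hD, natDegree_prod_of_monic _ _ fun k _ => monic_X_sub_C _]
    simp only [natDegree_X_sub_C]; simp
  have hqdeg : q.natDegree ≤ 2 := by
    have hq0 : q ≠ 0 := by rintro rfl; simp [hq] at hp
    have := hDmonic.natDegree_mul' hq0
    rw [← hq] at this
    omega
  have hqX := q.as_sum_range_C_mul_X_pow' (n := 3) (by omega)
  simp only [Finset.sum_range_succ, Finset.sum_range_zero, zero_add, pow_zero, mul_one,
    pow_one] at hqX
  have hlead : p.coeff (N + 2) = q.coeff 2 := by
    rw [hq, coeff_mul_add_eq_of_natDegree_le hDdeg.le hqdeg]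
    have : D.coeff N = 1 := by rw [← hDdeg]; exact hDmonic
    rw [this, one_mul]
  set Z := ∏ k ∈ Finset.range N, z k with hZ
  have hDZ : D = C Z * ∏ k ∈ Finset.range N, (1 + C (1 / z k) * X) := by
    rw [hD, hZ, map_prod, ← Finset.prod_mul_distrib]
    refine Finset.prod_congr rfl fun k hk => ?_
    have := (hz k (Finset.mem_range.1 hk)).ne'
    rw [mul_add, ← mul_assoc, ← C_mul, mul_one_div_cancel this]
    simp [add_comm]
  have h0 : Z * q.coeff 0 = 1 := by
    rw [← hp, hq, mul_coeff_zero, hDZ, mul_coeff_zero, coeff_zero_prod]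
    simp
  refine ⟨Z * q.coeff 1, ?_⟩
  have hC0 : C Z * C (q.coeff 0) = 1 := by rw [← C_mul, h0, C_1]
  rw [hlead]
  conv_lhs => rw [hq, hDZ, hqX]
  rw [← hC0]
  simp only [C_mul]
  ring

namespace IsAlternatingQuotient

variable {c : ℕ → ℝ} {a b x : ℝ}

/-- The coefficient ratios telescope down to `c 1 = 1`. -/
theorem prod_mul_le (h : IsAlternatingQuotient c a b) {N : ℕ}
    {z : ℕ → ℝ} (hz : ∀ k < N, 0 < z k) (hle : ∀ k < N, c (k + 2) * z k ≤ c (k + 1)) :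
    c (N + 1) * ∏ k ∈ Finset.range N, z k ≤ 1 := by
  induction N with
  | zero => simp [h.one]
  | succ N ih =>
    have h1 := ih (fun k hk => hz k (by omega)) fun k hk => hle k (by omega)
    have h2 : 0 ≤ ∏ k ∈ Finset.range N, z k :=
      Finset.prod_nonneg fun k hk => (hz k (by have := Finset.mem_range.1 hk; omega)).le
    rw [Finset.prod_range_succ]
    nlinarith [mul_le_mul_of_nonneg_right (hle N (by omega)) h2]

/-- Factorisation of the odd sections, with all but two of the zeros in prescribed intervals. -/
theorem exists_section_factorization (h : IsAlternatingQuotient c a (b ^ 2)) (ha : 3 < a)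
    (hb : 1 < b) (hab : a < b ^ 2) (hx : 1 < x) (hxa : x ≤ a)
    (hneg : ∀ m, oddSection c m x < 0) (m : ℕ) :
    ∃ (α γ : ℝ) (y : ℕ → ℝ), 0 ≤ γ ∧ γ ≤ 1 / (a * b ^ 2) ^ (m + 1) ∧
      (∀ k, 0 ≤ y k ∧ y k ≤ 9 * (1 / 3) ^ k) ∧
      ∀ z : ℂ, ∑ k ∈ Finset.range (2 * (m + 1) + 2), (c k : ℂ) * z ^ k =
        (1 + α * z + γ * z ^ 2) * ∏' k, (1 + (y k : ℂ) * z) := by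
  have ha0 : 0 < a := by linarith
  have hb0 : 0 < b := by linarith
  set t := samplePoint (a * b ^ 2) x (a * b) with ht
  have hmono : StrictMono t :=
    strictMono_samplePoint (by positivity) hx (by nlinarith)
      (by nlinarith [mul_pos ha0 hb0, mul_pos (mul_pos ha0 hb0) hb0])
  have htlow : ∀ k, 3 ^ k / 9 ≤ t k := le_samplePoint (by nlinarith) hx.le (by nlinarith)
  obtain ⟨z, hz⟩ := h.exists_oddSection_roots ha hb hab hx hneg hmono (m + 1)
  set N := 2 * (m + 1) - 1 with hN
  have hzlow : ∀ k < N, 3 ^ k / 9 < z k := fun k hk => (htlow k).trans_lt (hz k hk).2.1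
  have hzpos : ∀ k < N, 0 < z k := fun k hk => lt_trans (by positivity) (hzlow k hk)
  have hzmono : StrictMonoOn z (Finset.range N) := by
    intro i hi j hj hij
    have hi := Finset.mem_range.1 hi
    have hj := Finset.mem_range.1 hj
    exact (hz i hi).2.2.trans ((hmono.monotone hij).trans_lt (hz j hj).2.1)
  set p : Polynomial ℝ := ∑ k ∈ Finset.range (2 * (m + 1) + 2),
    Polynomial.C (c k) * Polynomial.X ^ k with hp
  have hcoeff : ∀ j < 2 * (m + 1) + 2, p.coeff j = c j := by
    intro j hj
    simp only [hp, Polynomial.finsetSum_coeff, Polynomial.coeff_C_mul_X_pow]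
    simp [hj]
  have hpdeg : p.natDegree ≤ N + 2 := by
    refine Polynomial.natDegree_sum_le_of_forall_le _ _ fun k hk => ?_
    have := Finset.mem_range.1 hk
    exact (Polynomial.natDegree_C_mul_X_pow_le _ _).trans (by omega)
  obtain ⟨α, hα⟩ := Polynomial.exists_eq_quadratic_mul_prod hpdeg
    (by rw [hcoeff 0 (by omega), h.zero]) hzpos hzmono.injOn (by
      intro k hk
      rw [← (hz k hk).1]
      simp [hp, Polynomial.eval_finsetSum, oddSection])
  rw [hcoeff _ (by omega)] at hα
  set Z := ∏ k ∈ Finset.range N, z k with hZ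
  have hZ0 : 0 ≤ Z := Finset.prod_nonneg fun k hk => (hzpos k (Finset.mem_range.1 hk)).le
  refine ⟨α, c (N + 2) * Z, fun k => if k < N then 1 / z k else 0,
    mul_nonneg (h.pos ha0 (by positivity) _).le hZ0, ?_, ?_, ?_⟩
  -- `prod_mul_le` gives c(N+1)·Z ≤ 1, and c(N+1) = Q^(m+1) c(N+2) because N+1 = 2(m+1) is even.
  · have h1 := h.prod_mul_le (N := N) hzpos fun k hk =>
      (mul_le_mul_of_nonneg_left (hz k hk).2.2.le (h.pos ha0 (by positivity) _).le).trans
        (h.mul_samplePoint_le ha0 (by positivity) hxa (by nlinarith [mul_pos ha0 hb0]) k)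
    have h2 := h.ratio_even ha0 (by positivity) (m + 1)
    rw [le_div_iff₀ (by positivity)]
    rw [show N + 1 = 2 * (m + 1) by omega, h2] at h1
    rw [show N + 2 = 2 * (m + 1) + 1 by omega]
    linarith
  · intro k
    dsimp only
    split_ifs with hk
    · have := hzlow k hk
      refine ⟨(one_div_pos.2 (hzpos k hk)).le, ?_⟩
      calc 1 / z k ≤ 1 / (3 ^ k / 9) := one_div_le_one_div_of_le (by positivity) this.le
        _ = 9 * (1 / 3) ^ k := by rw [one_div_pow]; field_simp
    · exact ⟨le_rfl, by positivity⟩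
  · intro w
    have e := congrArg (Polynomial.aeval w) hα
    simp only [hp, map_sum, map_mul, map_add, map_one, map_prod, Polynomial.aeval_C,
      Polynomial.aeval_X, map_pow, Complex.coe_algebraMap] at e
    rw [e, tprod_eq_prod (s := Finset.range N)]
    · push_cast
      congr 1
      refine Finset.prod_congr rfl fun k hk => ?_
      simp [Finset.mem_range.1 hk]
    · intro k hk
      dsimp only
      rw [if_neg fun hk' => hk (Finset.mem_range.2 hk')]
      simp

end IsAlternatingQuotient

/-! ### Passage to the limit. -/

open Filter Topology

theorem differentiable_of_hasSum_pow {f : ℂ → ℂ} {c : ℕ → ℝ}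
    (hf : ∀ z : ℂ, HasSum (fun k : ℕ => (c k : ℂ) * z ^ k) (f z)) : Differentiable ℂ f := by
  have hfun : f = fun z => ∑' k, (c k : ℂ) * z ^ k := funext fun z => (hf z).tsum_eq.symm
  intro z
  rw [hfun]
  set R : ℝ := ‖z‖ + 1 with hR
  have hR0 : 0 ≤ R := by positivity
  have hu : Summable fun k => ‖(c k : ℂ) * (R : ℂ) ^ k‖ := (hf R).summable.norm
  have hd := Complex.differentiableOn_tsum_of_summable_norm (F := fun k (z : ℂ) => (c k : ℂ) * z ^ k)
    (U := Metric.ball 0 R) hu (fun k => by fun_prop) Metric.isOpen_ball fun k w hw => by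
      have hw : ‖w‖ ≤ R := by simpa using (mem_ball_zero_iff.1 hw).le
      rw [norm_mul, norm_mul, norm_pow, norm_pow, Complex.norm_real R, Real.norm_of_nonneg hR0]
      gcongr
  exact hd.differentiableAt (Metric.isOpen_ball.mem_nhds (by simp [hR]))

theorem hasSum_re_of_hasSum_pow {c : ℕ → ℝ} {x : ℝ} {s : ℂ}
    (hs : HasSum (fun k : ℕ => (c k : ℂ) * (x : ℂ) ^ k) s) :
    HasSum (fun k : ℕ => c k * x ^ k) s.re ∧ s.im = 0 := by
  have h : (fun k : ℕ => (c k : ℂ) * (x : ℂ) ^ k) = fun k => ((c k * x ^ k : ℝ) : ℂ) := by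
    funext k; push_cast; rfl
  rw [h] at hs
  refine ⟨by simpa only [Complex.ofReal_re] using Complex.hasSum_re hs, ?_⟩
  have := Complex.hasSum_im hs
  simp only [Complex.ofReal_im] at this
  exact this.unique hasSum_zero

/-- A convergent product of factors `1 + Y k * z` with `0 ≤ Y k` belongs to the
Laguerre–Pólya class of type I. -/
theorem laguerrePolyaI_of_eq_tprod {f : ℂ → ℂ} (hf : IsRealEntire f) (A : ℝ) {Y : ℕ → ℝ}
    (hY : ∀ k, 0 ≤ Y k) (hsum : Summable Y)
    (hprod : ∀ z, f z = A * ∏' k, (1 + (Y k : ℂ) * z)) : LaguerrePolyaI f := by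
  -- Indices with `Y k = 0` contribute the factor 1 and are left out of the index set.
  refine ⟨hf, A, 0, 0, {k | 0 < Y k}, fun k => 1 / Y k, le_rfl, fun k => one_div_pos.2 k.2, ?_,
    fun z => ?_⟩
  · simp only [one_div_one_div]
    exact hsum.subtype {k | 0 < Y k}
  · rw [hprod z, ← tprod_subtype_eq_of_mulSupport_subset (s := {k | 0 < Y k})]
    · simp [div_eq_mul_inv, mul_comm]
    · intro k hk
      by_contra h
      have : Y k = 0 := le_antisymm (not_lt.1 h) (hY k)
      simp [this] at hk

namespace IsAlternatingQuotient

variable {c : ℕ → ℝ} {a b x : ℝ} {F : ℂ → ℂ}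

/-- If all odd sections are negative at some `-x` with `1 < x ≤ a`, then the power series is a
product of linear factors with non-positive zeros. -/
theorem exists_eq_tprod_of_oddSection_neg (h : IsAlternatingQuotient c a (b ^ 2)) (ha : 3 < a)
    (hb : 1 < b) (hab : a < b ^ 2) (hx : 1 < x) (hxa : x ≤ a)
    (hneg : ∀ m, oddSection c m x < 0)
    (hF : ∀ z : ℂ, HasSum (fun k : ℕ => (c k : ℂ) * z ^ k) (F z)) :
    ∃ Y : ℕ → ℝ, (∀ k, 0 ≤ Y k) ∧ Summable Y ∧ ∀ z, F z = ∏' k, (1 + (Y k : ℂ) * z) := by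
  choose α γ y hγ0 hγ hy hprod using h.exists_section_factorization ha hb hab hx hxa hneg
  have hbd : Summable fun k : ℕ => 9 * (1 / 3 : ℝ) ^ k :=
    (summable_geometric_of_lt_one (by norm_num) (by norm_num)).mul_left 9
  -- The sequences of reciprocals lie in a product of compact intervals, so a subsequence converges
  -- coordinatewise.
  obtain ⟨w, hw, φ, hφ, hlim⟩ := (isCompact_Icc (a := (0 : ℕ → ℝ))
    (b := fun k => 9 * (1 / 3 : ℝ) ^ k)).tendsto_subseq (x := y)
    fun m => ⟨fun k => (hy m k).1, fun k => (hy m k).2⟩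
  have hw0 : ∀ k, 0 ≤ w k := hw.1
  have hwsum : Summable w := hbd.of_nonneg_of_le hw0 hw.2
  have hγlim : Tendsto (fun m => γ (φ m)) atTop (𝓝 0) := by
    have hg : Tendsto (fun m : ℕ => 1 / (a * b ^ 2) ^ (m + 1)) atTop (𝓝 0) := by
      have hQ : 1 < a * b ^ 2 := by nlinarith
      simp_rw [← one_div_pow]
      exact (tendsto_pow_atTop_nhds_zero_of_lt_one (by positivity)
        ((div_lt_one (by linarith)).2 hQ)).comp (tendsto_add_atTop_nat 1)
    exact (squeeze_zero hγ0 hγ hg).comp hφ.tendsto_atTop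
  have hS : ∀ z : ℂ, Tendsto (fun m => ∑ k ∈ Finset.range (2 * (φ m + 1) + 2), (c k : ℂ) * z ^ k)
      atTop (𝓝 (F z)) := fun z => (hF z).tendsto_sum_nat.comp
    (tendsto_atTop_mono (fun m => by have := hφ.id_le m; simp only [id] at *; omega :
      ∀ m : ℕ, m ≤ 2 * (φ m + 1) + 2) tendsto_id)
  have hP : ∀ z : ℂ, Tendsto (fun m => ∏' k, (1 + (y (φ m) k : ℂ) * z)) atTop
      (𝓝 (∏' k, (1 + (w k : ℂ) * z))) := by
    intro z
    refine tendsto_tprod_one_add_of_dominated_convergence (hbd.mul_right ‖z‖) (fun k => ?_)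
      (Eventually.of_forall fun m k => ?_)
    · exact ((Complex.continuous_ofReal.tendsto _).comp
        ((continuous_apply k).tendsto _ |>.comp hlim)).mul_const z
    · rw [norm_mul, Complex.norm_real, Real.norm_of_nonneg (hy _ _).1]
      gcongr
      exact (hy _ _).2
  have hG1 : ∏' k, (1 + (w k : ℂ) * 1) ≠ 0 := by
    refine tprod_one_add_ne_zero_of_summable (fun k => ?_) ?_
    · have : (1 : ℝ) + w k ≠ 0 := (by linarith [hw0 k] : 0 < 1 + w k).ne'
      rw [mul_one]
      exact_mod_cast this
    · simpa using hwsum.abs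
  -- Evaluation at z = 1, where the limit product is nonzero, isolates α + γ; and γ → 0.
  have hαlim : ∃ l : ℝ, Tendsto (fun m => α (φ m)) atTop (𝓝 l) := by
    have h1 := (hS 1).div (hP 1) hG1
    have h2 : Tendsto (fun m => ((α (φ m) + γ (φ m) : ℝ) : ℂ)) atTop
        (𝓝 (F 1 / ∏' k, (1 + (w k : ℂ) * 1) - 1)) := by
      refine (h1.sub_const 1).congr' ?_
      filter_upwards [(hP 1).eventually_ne hG1] with m hm
      simp only [Pi.div_apply]
      rw [hprod, mul_div_cancel_right₀ _ hm]
      push_cast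
      ring
    have h3 := ((Complex.continuous_re.tendsto _).comp h2).sub hγlim
    exact ⟨_, h3.congr fun m => by simp⟩
  obtain ⟨l, hl⟩ := hαlim
  have hfac : ∀ z, F z = (1 + (l : ℂ) * z) * ∏' k, (1 + (w k : ℂ) * z) := by
    intro z
    refine tendsto_nhds_unique (hS z) ?_
    simp_rw [hprod]
    refine Tendsto.mul ?_ (hP z)
    have h1 := ((Complex.continuous_ofReal.tendsto _).comp hl).mul_const z
    have h2 := ((Complex.continuous_ofReal.tendsto _).comp hγlim).mul_const (z ^ 2)
    simpa using (h1.const_add 1).add h2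
  -- A negative `l` would give F a zero at the positive point -1/l, where its series is at least 1.
  have hl0 : 0 ≤ l := by
    by_contra! hneg
    have ht : 0 < -1 / l := div_pos_of_neg_of_neg (by norm_num) hneg
    have hz := hfac ((-1 / l : ℝ) : ℂ)
    rw [← Complex.ofReal_mul, mul_div_cancel₀ _ hneg.ne] at hz
    have hs := (hasSum_re_of_hasSum_pow (hF ((-1 / l : ℝ) : ℂ))).1
    rw [hz] at hs
    have hc : ∀ k, 0 < c k := h.pos (by linarith) (by positivity)
    have := le_hasSum hs 0 fun k _ => by have := hc k; positivity
    simp [h.zero] at this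
    linarith
  refine ⟨fun k => Nat.casesOn k l w, fun k => ?_, ?_, fun z => ?_⟩
  · cases k <;> simp [hl0, hw0]
  · exact (summable_nat_add_iff 1).1 hwsum
  · rw [tprod_eq_zero_mul', hfac z]
    · rfl
    · exact Complex.multipliable_one_add_of_summable
        ((Complex.summable_ofReal.2 hwsum).mul_right z)

theorem exists_eq_tprod (h : IsAlternatingQuotient c a b) (ha : 1 < a) (hab : a < b)
    (hF : ∀ z : ℂ, HasSum (fun k : ℕ => (c k : ℂ) * z ^ k) (F z))
    (hx0 : 0 ≤ x) (hxa : x ≤ a) (hx : (F ((-x : ℝ) : ℂ)).re ≤ 0) :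
    ∃ Y : ℕ → ℝ, (∀ k, 0 ≤ Y k) ∧ Summable Y ∧ ∀ z, F z = ∏' k, (1 + (Y k : ℂ) * z) := by
  have hs := (hasSum_re_of_hasSum_pow (hF ((-x : ℝ) : ℂ))).1
  have hb : 1 < b := ha.trans hab
  have hx0 : 0 < x := by
    refine hx0.lt_of_ne fun e => ?_
    subst e
    have := hs.unique (hasSum_single 0 fun k hk => by simp [hk])
    simp [h.zero] at this
    simp [this] at hx
    linarith
  have hneg : ∀ m, oddSection c m x < 0 := fun m =>
    (h.oddSection_lt_of_hasSum ha hb hx0 (by nlinarith) hs m).trans_le hx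
  have hx1 : 1 < x := by have := hneg 0; rw [h.oddSection_zero] at this; linarith
  have ha3 := h.three_lt_of_oddSection_neg ha hab hx0 hxa (hneg 1)
  have hsq : √b ^ 2 = b := Real.sq_sqrt (by linarith)
  refine exists_eq_tprod_of_oddSection_neg (b := √b) (hsq.symm ▸ h) ha3 ?_ (hsq.symm ▸ hab) hx1 hxa
    hneg hF
  rw [← Real.sqrt_one]
  exact Real.sqrt_lt_sqrt (by norm_num) hb

/-! ### Normalisation and sufficiency. -/

theorem of_secondQuotient (hpos : ∀ k, 0 < c k) (h0 : c 0 = 1) (h1 : c 1 = 1)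
    (ha : 0 < a) (hb : 0 < b)
    (heven : ∀ m : ℕ, 1 ≤ m → secondQuotient c (2 * m) = a)
    (hodd : ∀ m : ℕ, 1 ≤ m → secondQuotient c (2 * m + 1) = b) : IsAlternatingQuotient c a b := by
  -- A second quotient is a quotient of successive ratios c(k)/c(k+1), so these ratios start at 1
  -- and gain the factors a and b alternately.
  have he : ∀ m, c (2 * m + 1) ^ 2 = a * (c (2 * m) * c (2 * m + 2)) := by
    intro m
    have := heven (m + 1) (by omega)
    rw [secondQuotient, show 2 * (m + 1) - 1 = 2 * m + 1 by omega,
      show 2 * (m + 1) - 2 = 2 * m by omega, show 2 * (m + 1) = 2 * m + 2 by ring] at this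
    rwa [div_eq_iff (mul_pos (hpos _) (hpos _)).ne'] at this
  have ho : ∀ m, c (2 * m + 2) ^ 2 = b * (c (2 * m + 1) * c (2 * m + 3)) := by
    intro m
    have := hodd (m + 1) (by omega)
    rw [secondQuotient, show 2 * (m + 1) + 1 - 1 = 2 * m + 2 by omega,
      show 2 * (m + 1) + 1 - 2 = 2 * m + 1 by omega, show 2 * (m + 1) + 1 = 2 * m + 3 by ring]
      at this
    rwa [div_eq_iff (mul_pos (hpos _) (hpos _)).ne'] at this
  have hodd' : ∀ m, c (2 * m) = (a * b) ^ m * c (2 * m + 1) →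
      c (2 * m + 1) = a * (a * b) ^ m * c (2 * m + 2) := by
    intro m e
    have := he m
    rw [e] at this
    exact mul_left_cancel₀ (hpos (2 * m + 1)).ne' (by linear_combination this)
  have hev : ∀ m, c (2 * m) = (a * b) ^ m * c (2 * m + 1) := by
    intro m
    induction m with
    | zero => simp [h0, h1]
    | succ m ih =>
      have e := ho m
      rw [hodd' m ih] at e
      rw [show 2 * (m + 1) = 2 * m + 2 by ring, show 2 * m + 2 + 1 = 2 * m + 3 by ring]
      exact mul_left_cancel₀ (hpos (2 * m + 2)).ne' (by linear_combination e)
  refine ⟨h0, h1, fun k => ?_⟩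
  rw [eq_div_iff (by positivity)]
  obtain ⟨m, rfl | rfl⟩ := Nat.even_or_odd' k
  · rw [hev m, hodd' m (hev m)]
    ring
  · rw [hodd' m (hev m), show 2 * m + 2 = 2 * (m + 1) by ring, hev (m + 1),
      show 2 * (m + 1) + 1 = 2 * m + 1 + 2 by ring]
    ring

end IsAlternatingQuotient

theorem secondQuotient_mul_geometric {A : ℕ → ℝ} {s t : ℝ} (hs : s ≠ 0) (ht : t ≠ 0) {n : ℕ}
    (hn : 2 ≤ n) : secondQuotient (fun k => s * A k * t ^ k) n = secondQuotient A n := by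
  obtain ⟨n, rfl⟩ : ∃ j, n = j + 2 := ⟨n - 2, by omega⟩
  simp only [secondQuotient, show n + 2 - 1 = n + 1 by omega, Nat.add_sub_cancel]
  rw [show (s * A (n + 1) * t ^ (n + 1)) ^ 2 = (s * t ^ (n + 1)) ^ 2 * A (n + 1) ^ 2 by ring,
    show s * A n * t ^ n * (s * A (n + 2) * t ^ (n + 2)) =
      (s * t ^ (n + 1)) ^ 2 * (A n * A (n + 2)) by ring]
  exact mul_div_mul_left _ _ (by positivity)

theorem laguerrePolyaI_of_nonpos_value {f : ℂ → ℂ} {A : ℕ → ℝ} (hpos : ∀ k, 0 < A k)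
    (hf : ∀ z : ℂ, HasSum (fun k : ℕ => (A k : ℂ) * z ^ k) (f z))
    {a b : ℝ} (ha : 1 < a) (hab : a < b)
    (heven : ∀ m : ℕ, 1 ≤ m → secondQuotient A (2 * m) = a)
    (hodd : ∀ m : ℕ, 1 ≤ m → secondQuotient A (2 * m + 1) = b)
    {z₀ : ℝ} (hz₀ : z₀ ∈ Set.Icc (-(A 1 / A 2)) 0) (hfz : f z₀ ≤ 0) : LaguerrePolyaI f := by
  have hA0 := hpos 0
  have hA1 := hpos 1
  have hA2 := hpos 2
  have hreal : IsRealEntire f :=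
    ⟨differentiable_of_hasSum_pow hf, fun x => (hasSum_re_of_hasSum_pow (hf x)).2⟩
  -- This scale makes `c 1 = 1` and sends the endpoint `A 1 / A 2` to `a`.
  set ρ := A 0 / A 1 with hρ
  have hρ0 : 0 < ρ := div_pos hA0 hA1
  set c : ℕ → ℝ := fun k => (A 0)⁻¹ * A k * ρ ^ k with hc
  have hF : ∀ z : ℂ, HasSum (fun k : ℕ => (c k : ℂ) * z ^ k) ((A 0 : ℂ)⁻¹ * f (ρ * z)) := by
    intro z
    refine ((hf (ρ * z)).mul_left (A 0 : ℂ)⁻¹).congr_fun fun k => ?_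
    simp only [hc]
    push_cast
    ring
  have h : IsAlternatingQuotient c a b := by
    refine .of_secondQuotient (fun k => ?_) ?_ ?_ (by linarith) (by linarith) (fun m hm => ?_)
      fun m hm => ?_
    · have := hpos k
      positivity
    · simp [hc, hA0.ne']
    · simp only [hc, hρ]; field_simp
    · rw [secondQuotient_mul_geometric (inv_pos.2 hA0).ne' hρ0.ne' (by omega), heven m hm]
    · rw [secondQuotient_mul_geometric (inv_pos.2 hA0).ne' hρ0.ne' (by omega), hodd m hm]
  have haρ : A 1 / A 2 = a * ρ := by
    rw [← heven 1 le_rfl, secondQuotient, hρ]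
    simp only [mul_one, Nat.reduceSub]
    field_simp
  rw [haρ] at hz₀
  obtain ⟨Y, hY, hYsum, hprod⟩ := h.exists_eq_tprod (x := -z₀ / ρ) ha hab hF
    (div_nonneg (by linarith [hz₀.2]) hρ0.le)
    ((div_le_iff₀ hρ0).2 (by linarith [hz₀.1])) (by
      have e : (ρ : ℂ) * ((-(-z₀ / ρ) : ℝ) : ℂ) = z₀ := by
        rw [← Complex.ofReal_mul]; congr 1; field_simp
      rw [e, ← Complex.ofReal_inv, Complex.re_ofReal_mul]
      exact mul_nonpos_of_nonneg_of_nonpos (inv_pos.2 hA0).le (Complex.le_def.1 hfz).1)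
  refine laguerrePolyaI_of_eq_tprod hreal (A 0) (Y := fun k => Y k * ρ⁻¹)
    (fun k => mul_nonneg (hY k) (inv_pos.2 hρ0).le) (hYsum.mul_right _) fun z => ?_
  have hρc : (ρ : ℂ) ≠ 0 := Complex.ofReal_ne_zero.2 hρ0.ne'
  have hAc : (A 0 : ℂ) ≠ 0 := Complex.ofReal_ne_zero.2 hA0.ne'
  have e := hprod ((ρ : ℂ)⁻¹ * z)
  rw [mul_inv_cancel_left₀ hρc, inv_mul_eq_iff_eq_mul₀ hAc] at e
  rw [e]
  push_cast
  simp only [mul_assoc]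

/-! ### Third order expansions of logarithms. -/

open Filter Topology Asymptotics

theorem Real.abs_log_one_add_sub_cubic_le {s : ℝ} (hs : |s| ≤ 1 / 2) :
    |Real.log (1 + s) - (s - s ^ 2 / 2 + s ^ 3 / 3)| ≤ 2 * s ^ 4 := by
  have h := Real.abs_log_sub_add_sum_range_le (x := -s) (by rw [abs_neg]; linarith) 3
  simp only [Finset.sum_range_succ, Finset.sum_range_zero, abs_neg, sub_neg_eq_add] at h
  norm_num at h
  have e : Real.log (1 + s) - (s - s ^ 2 / 2 + s ^ 3 / 3) =
      -s + s ^ 2 / 2 + (-s) ^ 3 / 3 + Real.log (1 + s) := by ring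
  rw [e]
  refine h.trans ?_
  rw [Even.pow_abs (by decide), div_le_iff₀ (by linarith)]
  nlinarith [pow_nonneg (sq_nonneg s) 2, mul_nonneg (pow_nonneg (sq_nonneg s) 2)
    (by linarith : 0 ≤ 1 / 2 - |s|)]

theorem Real.log_one_add_sub_cubic_isBigO :
    (fun s : ℝ => Real.log (1 + s) - (s - s ^ 2 / 2 + s ^ 3 / 3)) =O[𝓝 0] fun s => s ^ 4 := by
  refine IsBigO.of_bound 2 ?_
  filter_upwards [Metric.closedBall_mem_nhds (0 : ℝ) (by norm_num : (0 : ℝ) < 1 / 2)] with s hs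
  have hs : |s| ≤ 1 / 2 := by simpa using hs
  rw [Real.norm_eq_abs, Real.norm_of_nonneg (by positivity)]
  exact Real.abs_log_one_add_sub_cubic_le hs

/-- Third order expansion at `0` of the logarithm of a product of linear factors. -/
theorem tsum_log_one_add_isBigO {ι : Type*} {y : ι → ℝ} (hy : ∀ k, 0 ≤ y k)
    (h1 : Summable y) (h2 : Summable fun k => y k ^ 2) (h3 : Summable fun k => y k ^ 3)
    (h4 : Summable fun k => y k ^ 4) :
    (fun t : ℝ => ∑' k, Real.log (1 + y k * t) -
      ((∑' k, y k) * t - (∑' k, y k ^ 2) * t ^ 2 / 2 + (∑' k, y k ^ 3) * t ^ 3 / 3))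
      =O[𝓝[>] 0] fun t => t ^ 4 := by
  refine IsBigO.of_bound (2 * ∑' k, y k ^ 4) ?_
  have hE : 0 ≤ ∑' k, y k := tsum_nonneg hy
  -- Each `y k` is at most the total sum, so the cubic bound applies to all factors at once.
  have hev : ∀ᶠ t : ℝ in 𝓝[>] 0, (∑' k, y k) * t < 1 / 2 := by
    have hc : Continuous fun t : ℝ => (∑' k, y k) * t := by fun_prop
    exact nhdsWithin_le_nhds (hc.continuousAt.eventually_lt_const (by simp))
  filter_upwards [hev, self_mem_nhdsWithin] with t ht ht0
  have ht0 : 0 < t := ht0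
  have hs : ∀ k, |y k * t| ≤ 1 / 2 := fun k => by
    rw [abs_of_nonneg (mul_nonneg (hy k) ht0.le)]
    have := h1.le_tsum k fun j _ => hy j
    nlinarith
  have hlog := Real.summable_log_one_add_of_summable (h1.mul_right t)
  have hpoly := ((h1.mul_right t).hasSum.sub ((h2.mul_right (t ^ 2 / 2)).hasSum)).add
    ((h3.mul_right (t ^ 3 / 3)).hasSum)
  have hdiff := hlog.hasSum.sub hpoly
  have hval : ∑' k, Real.log (1 + y k * t) -
      ((∑' k, y k) * t - (∑' k, y k ^ 2) * t ^ 2 / 2 + (∑' k, y k ^ 3) * t ^ 3 / 3) =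
      ∑' k, Real.log (1 + y k * t) - (∑' k, y k * t - ∑' k, y k ^ 2 * (t ^ 2 / 2) +
        ∑' k, y k ^ 3 * (t ^ 3 / 3)) := by
    rw [tsum_mul_right, tsum_mul_right, tsum_mul_right]; ring
  rw [hval, Real.norm_of_nonneg (by positivity : 0 ≤ t ^ 4), mul_assoc, ← tsum_mul_right,
    ← tsum_mul_left, ← hdiff.tsum_eq]
  refine tsum_of_norm_bounded ((h4.mul_right (t ^ 4)).mul_left 2).hasSum fun k => ?_
  have := Real.abs_log_one_add_sub_cubic_le (hs k)
  rw [Real.norm_eq_abs]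
  convert this using 2 <;> ring

/-- Third order expansion of `log (1 + h)` from that of `h`. -/
theorem log_one_add_isBigO_of_cubic {h : ℝ → ℝ} {g₁ g₂ g₃ : ℝ}
    (hh : (fun t => h t - (g₁ * t + g₂ * t ^ 2 + g₃ * t ^ 3)) =O[𝓝[>] 0] fun t => t ^ 4) :
    (fun t => Real.log (1 + h t) - (g₁ * t + (g₂ - g₁ ^ 2 / 2) * t ^ 2 +
      (g₃ - g₁ * g₂ + g₁ ^ 3 / 3) * t ^ 3)) =O[𝓝[>] 0] fun t => t ^ 4 := by
  set P : ℝ → ℝ := fun t => g₁ * t + g₂ * t ^ 2 + g₃ * t ^ 3 with hP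
  have hbdd : ∀ q : ℝ → ℝ, Continuous q → q =O[𝓝[>] 0] fun _ => (1 : ℝ) := fun q hq =>
    (hq.continuousAt.tendsto.mono_left nhdsWithin_le_nhds).isBigO_one ℝ
  have ht1 : (fun t : ℝ => t) =O[𝓝[>] 0] fun _ => (1 : ℝ) := hbdd _ continuous_id
  have h41 : (fun t : ℝ => t ^ 4) =O[𝓝[>] 0] fun t => t := by
    have := (isBigO_refl (fun t : ℝ => t) (𝓝[>] 0)).mul (hbdd (fun t => t ^ 3) (by fun_prop))
    refine (this.congr_left fun t => ?_).congr_right fun t => ?_ <;> ring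
  have hPt : P =O[𝓝[>] 0] fun t => t := by
    have := (isBigO_refl (fun t : ℝ => t) (𝓝[>] 0)).mul
      (hbdd (fun t => g₁ + g₂ * t + g₃ * t ^ 2) (by fun_prop))
    refine (this.congr_left fun t => ?_).congr_right fun t => ?_
    · simp only [hP]; ring
    · ring
  have hht : h =O[𝓝[>] 0] fun t => t := by
    refine ((hh.trans h41).add hPt).congr_left fun t => ?_
    simp only [hP]; ring
  have hh1 := hht.trans ht1
  have hP1 := hPt.trans ht1
  have hh0 : Tendsto h (𝓝[>] 0) (𝓝 0) :=
    hht.trans_tendsto (tendsto_id.mono_left nhdsWithin_le_nhds)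
  have e1 := (Real.log_one_add_sub_cubic_isBigO.comp_tendsto hh0).trans (hht.pow 4)
  -- With T(s) = s - s²/2 + s³/3, the logarithm is (log(1+h) - T(h)) + (T(h) - T(P)) + T(P). This is
  -- the middle difference with h - P factored out.
  have e2 : (fun t => (h t - P t) * (1 - (h t + P t) / 2 + (h t ^ 2 + h t * P t + P t ^ 2) / 3))
      =O[𝓝[>] 0] fun t => t ^ 4 := by
    have hq : (fun t => 1 - (h t + P t) / 2 + (h t ^ 2 + h t * P t + P t ^ 2) / 3)
        =O[𝓝[>] 0] fun _ => (1 : ℝ) := by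
      have hone : (fun _ : ℝ => (1 : ℝ)) =O[𝓝[>] 0] fun _ => (1 : ℝ) := isBigO_refl _ _
      have a1 := (hh1.add hP1).const_mul_left (1 / 2)
      have a2 := (((hh1.pow 2).congr_right fun _ => one_pow 2).add
        ((hh1.mul hP1).congr_right fun _ => one_mul 1)).add
          ((hP1.pow 2).congr_right fun _ => one_pow 2)
      refine ((hone.sub a1).add (a2.const_mul_left (1 / 3))).congr_left fun t => ?_
      ring
    exact (hh.mul hq).congr_right fun t => mul_one _
  have e3 : (fun t => P t - P t ^ 2 / 2 + P t ^ 3 / 3 - (g₁ * t + (g₂ - g₁ ^ 2 / 2) * t ^ 2 +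
      (g₃ - g₁ * g₂ + g₁ ^ 3 / 3) * t ^ 3)) =O[𝓝[>] 0] fun t => t ^ 4 := by
    -- The second factor is the part of T(P(t)) of degree at least 4, divided by t⁴.
    have := (isBigO_refl (fun t : ℝ => t ^ 4) (𝓝[>] 0)).mul
      (hbdd (fun t => -(g₂ ^ 2 / 2 + g₁ * g₃) - g₂ * g₃ * t - g₃ ^ 2 * t ^ 2 / 2 +
        (3 * g₁ ^ 2 * g₂ + (3 * g₁ * g₂ ^ 2 + 3 * g₁ ^ 2 * g₃) * t +
          (g₂ ^ 3 + 6 * g₁ * g₂ * g₃) * t ^ 2 + (3 * g₂ ^ 2 * g₃ + 3 * g₁ * g₃ ^ 2) * t ^ 3 +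
          3 * g₂ * g₃ ^ 2 * t ^ 4 + g₃ ^ 3 * t ^ 5) / 3) (by fun_prop))
    refine (this.congr_left fun t => ?_).congr_right fun t => ?_
    · simp only [hP]; ring
    · ring
  refine ((e1.add e2).add e3).congr_left fun t => ?_
  simp only [Function.comp]
  ring

theorem eq_zero_of_continuous_isBigO_pow {q : ℝ → ℝ} (hq : Continuous q) {n : ℕ}
    (h : q =O[𝓝[>] 0] fun t => t ^ (n + 1)) : q 0 = 0 := by
  have h1 : Tendsto q (𝓝[>] 0) (𝓝 (q 0)) := hq.continuousAt.tendsto.mono_left nhdsWithin_le_nhds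
  refine tendsto_nhds_unique h1 (h.trans_tendsto ?_)
  have hc : Continuous fun t : ℝ => t ^ (n + 1) := by fun_prop
  have := hc.continuousAt (x := 0) |>.tendsto.mono_left (nhdsWithin_le_nhds (s := Set.Ioi 0))
  simpa using this

theorem isBigO_pow_of_mul_id {q : ℝ → ℝ} {n : ℕ}
    (h : (fun t => t * q t) =O[𝓝[>] 0] fun t => t ^ (n + 1)) :
    q =O[𝓝[>] 0] fun t => t ^ n := by
  refine ((isBigO_refl (fun t : ℝ => t⁻¹) (𝓝[>] 0)).mul h).congr' ?_ ?_ <;>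
    filter_upwards [self_mem_nhdsWithin] with t ht
  · exact inv_mul_cancel_left₀ (ne_of_gt ht) _
  · rw [pow_succ', inv_mul_cancel_left₀ (ne_of_gt ht)]

/-- Letting t → 0 kills the lowest coefficient; dividing by t exposes the next. -/
theorem cubic_coeff_eq_zero_of_isBigO {d₁ d₂ d₃ : ℝ}
    (h : (fun t : ℝ => d₁ * t + d₂ * t ^ 2 + d₃ * t ^ 3) =O[𝓝[>] 0] fun t => t ^ 4) :
    d₁ = 0 ∧ d₂ = 0 ∧ d₃ = 0 := by
  have h1 : (fun t : ℝ => d₁ + d₂ * t + d₃ * t ^ 2) =O[𝓝[>] 0] fun t => t ^ 3 :=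
    isBigO_pow_of_mul_id (h.congr_left fun t => by ring)
  have r1 : d₁ = 0 := by simpa using eq_zero_of_continuous_isBigO_pow (by fun_prop) h1
  subst r1
  have h2 : (fun t : ℝ => d₂ + d₃ * t) =O[𝓝[>] 0] fun t => t ^ 2 :=
    isBigO_pow_of_mul_id (h1.congr_left fun t => by ring)
  have r2 : d₂ = 0 := by simpa using eq_zero_of_continuous_isBigO_pow (by fun_prop) h2
  subst r2
  have h3 : (fun _ : ℝ => d₃) =O[𝓝[>] 0] fun t => t ^ 1 :=
    isBigO_pow_of_mul_id (h2.congr_left fun t => by ring)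
  exact ⟨rfl, rfl, by simpa using eq_zero_of_continuous_isBigO_pow (by fun_prop) h3⟩

/-- A power series with non-negative coefficients agrees with its cubic section to order `4`. -/
theorem hasSum_pow_sub_cubic_isBigO {A : ℕ → ℝ} {G : ℝ → ℝ} (hA : ∀ k, 0 ≤ A k)
    (hG : ∀ t, HasSum (fun k => A k * t ^ k) (G t)) :
    (fun t => G t - (A 0 + A 1 * t + A 2 * t ^ 2 + A 3 * t ^ 3)) =O[𝓝[>] 0] fun t => t ^ 4 := by
  refine IsBigO.of_bound (G 1) ?_
  filter_upwards [Ioo_mem_nhdsGT (show (0 : ℝ) < 1 by norm_num)] with t ht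
  have hs := (hasSum_nat_add_iff' 4).2 (hG t)
  have h1 := (hasSum_nat_add_iff' 4).2 (hG 1)
  simp only [Finset.sum_range_succ, Finset.sum_range_zero, zero_add, pow_zero, mul_one, pow_one,
    one_pow] at hs h1
  have hnn : ∀ k, 0 ≤ A (k + 4) * t ^ (k + 4) := fun k =>
    mul_nonneg (hA _) (pow_nonneg ht.1.le _)
  rw [Real.norm_of_nonneg (hs.nonneg hnn), Real.norm_of_nonneg (pow_nonneg ht.1.le _)]
  have h2 : G t - (A 0 + A 1 * t + A 2 * t ^ 2 + A 3 * t ^ 3) ≤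
      (G 1 - (A 0 + A 1 + A 2 + A 3)) * t ^ 4 := by
    refine hasSum_le (fun k => ?_) hs (h1.mul_right (t ^ 4))
    have : t ^ (k + 4) ≤ t ^ 4 := pow_le_pow_of_le_one ht.1.le ht.2.le (by omega)
    exact mul_le_mul_of_nonneg_left this (hA _)
  refine h2.trans (mul_le_mul_of_nonneg_right ?_ (pow_nonneg ht.1.le _))
  linarith [hA 0, hA 1, hA 2, hA 3]

/-! ### Power sums of reciprocal zeros and necessity. -/

theorem summable_pow_succ_of_summable {ι : Type*} {y : ι → ℝ} (hy : ∀ k, 0 ≤ y k)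
    (h : Summable y) (n : ℕ) : Summable fun k => y k ^ (n + 1) := by
  refine (h.mul_right ((∑' k, y k) ^ n)).of_nonneg_of_le (fun k => pow_nonneg (hy k) _) fun k => ?_
  rw [pow_succ']
  exact mul_le_mul_of_nonneg_left
    (pow_le_pow_left₀ (hy k) (h.le_tsum k fun j _ => hy j) n) (hy k)

/-- Newton's identities for the first three power sums of the reciprocal zeros. -/
theorem power_sums_of_eq_exp_mul_tprod {ι : Type*} {y : ι → ℝ} {β : ℝ} {A : ℕ → ℝ} {G : ℝ → ℝ}
    (hy : ∀ k, 0 ≤ y k) (hsum : Summable y) (hA : ∀ k, 0 ≤ A k) (hA0 : A 0 = 1)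
    (hG : ∀ t, HasSum (fun k => A k * t ^ k) (G t))
    (hprod : ∀ t, G t = Real.exp (β * t) * ∏' k, (1 + y k * t)) :
    A 1 = β + ∑' k, y k ∧ ∑' k, y k ^ 2 = A 1 ^ 2 - 2 * A 2 ∧
      ∑' k, y k ^ 3 = A 1 ^ 3 - 3 * A 1 * A 2 + 3 * A 3 := by
  have h1 := tsum_log_one_add_isBigO hy hsum (summable_pow_succ_of_summable hy hsum 1)
    (summable_pow_succ_of_summable hy hsum 2) (summable_pow_succ_of_summable hy hsum 3)
  have h2 := log_one_add_isBigO_of_cubic (h := fun t => G t - 1) (g₁ := A 1) (g₂ := A 2)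
    (g₃ := A 3) ((hasSum_pow_sub_cubic_isBigO hA hG).congr_left fun t => by rw [hA0]; ring)
  have hlog : ∀ᶠ t : ℝ in 𝓝[>] 0,
      Real.log (1 + (G t - 1)) = β * t + ∑' k, Real.log (1 + y k * t) := by
    filter_upwards [self_mem_nhdsWithin] with t ht
    have hpos : ∀ k, 0 < 1 + y k * t := fun k => by
      have := mul_nonneg (hy k) (le_of_lt ht); linarith
    rw [add_sub_cancel, hprod, ← Real.rexp_tsum_eq_tprod hpos
      (Real.summable_log_one_add_of_summable (hsum.mul_right t)), ← Real.exp_add, Real.log_exp]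
  have h3 : (fun t : ℝ => (A 1 - β - ∑' k, y k) * t +
      ((A 2 - A 1 ^ 2 / 2) + (∑' k, y k ^ 2) / 2) * t ^ 2 +
      ((A 3 - A 1 * A 2 + A 1 ^ 3 / 3) - (∑' k, y k ^ 3) / 3) * t ^ 3)
      =O[𝓝[>] 0] fun t => t ^ 4 := by
    refine (h1.sub h2).congr' (hlog.mono fun t ht => ?_) EventuallyEq.rfl
    dsimp only
    rw [ht]
    ring
  obtain ⟨r1, r2, r3⟩ := cubic_coeff_eq_zero_of_isBigO h3
  exact ⟨by linarith, by linarith, by linarith⟩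

/-- Otherwise p₃ ≤ (g/a) p₂, while Cauchy–Schwarz gives p₂² ≤ g p₃. With u = 3/b < 3/a these read a²
- 4a + 2 + u ≤ 0 and 4 - a ≤ u. The latter yields (a-1)(a-3) > 0, so a > 3; adding the two yields
(a-2)(a-3) ≤ 0. -/
theorem exists_le_of_power_sums {ι : Type*} {y : ι → ℝ} {g a b : ℝ} (hg : 0 < g)
    (ha : 1 < a) (hab : a < b) (hy : ∀ k, 0 ≤ y k) (hsum : Summable y) (h1 : ∑' k, y k ≤ g)
    (h2 : ∑' k, y k ^ 2 = g ^ 2 * (1 - 2 / a))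
    (h3 : ∑' k, y k ^ 3 = g ^ 3 * (1 - 3 / a + 3 / (a ^ 2 * b))) : ∃ k, g / a < y k := by
  by_contra! hle
  have ha0 : 0 < a := by linarith
  have hb0 : 0 < b := by linarith
  have s2 := summable_pow_succ_of_summable hy hsum 1
  have s3 := summable_pow_succ_of_summable hy hsum 2
  have i1 : ∑' k, y k ^ 3 ≤ g / a * ∑' k, y k ^ 2 := by
    rw [← tsum_mul_left]
    refine s3.tsum_le_tsum (fun k => ?_) (s2.mul_left _)
    rw [pow_succ']
    exact mul_le_mul_of_nonneg_right (hle k) (sq_nonneg _)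
  have i2 : 0 ≤ ∑' k, y k ^ 2 := tsum_nonneg fun k => sq_nonneg _
  -- The shift g(1 - 2/a) is p₂/g; expanding Σ y_k (y_k - p₂/g)² ≥ 0 and using p₁ ≤ g gives p₂² ≤ g
  -- p₃.
  have i3 : 0 ≤ ∑' k, y k ^ 3 - 2 * (g * (1 - 2 / a)) * ∑' k, y k ^ 2 +
      (g * (1 - 2 / a)) ^ 2 * ∑' k, y k := by
    have hs := (s3.hasSum.sub (s2.hasSum.mul_left (2 * (g * (1 - 2 / a))))).add
      (hsum.hasSum.mul_left ((g * (1 - 2 / a)) ^ 2))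
    refine hs.nonneg fun k => ?_
    have : y k ^ (2 + 1) - 2 * (g * (1 - 2 / a)) * y k ^ (1 + 1) + (g * (1 - 2 / a)) ^ 2 * y k =
        y k * (y k - g * (1 - 2 / a)) ^ 2 := by ring
    rw [this]
    exact mul_nonneg (hy k) (sq_nonneg _)
  have i4 := mul_le_mul_of_nonneg_left h1 (sq_nonneg (g * (1 - 2 / a)))
  rw [h2] at i1 i2 i3
  rw [h3] at i1 i3
  have j2 : 0 ≤ 1 - 2 / a := nonneg_of_mul_nonneg_right i2 (by positivity)
  have j1 : 1 - 3 / a + 3 / (a ^ 2 * b) ≤ 1 / a * (1 - 2 / a) := by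
    refine le_of_mul_le_mul_left (a := g ^ 3) ?_ (by positivity)
    calc _ ≤ _ := i1
      _ = _ := by ring
  have j3 : (1 - 2 / a) ^ 2 ≤ 1 - 3 / a + 3 / (a ^ 2 * b) := by
    refine le_of_mul_le_mul_left (a := g ^ 3) ?_ (by positivity)
    linarith
  have ha2 : 2 ≤ a := by
    rw [sub_nonneg, div_le_one ha0] at j2; exact j2
  have hu : 3 / b < 3 / a := div_lt_div_of_pos_left (by norm_num) ha0 hab
  have e : 3 / (a ^ 2 * b) = 3 / b / a ^ 2 := by field_simp
  rw [e] at j1 j3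
  set u := 3 / b
  have k1 : a ^ 2 - 3 * a + u ≤ a - 2 := by
    have := mul_le_mul_of_nonneg_left j1 (sq_nonneg a)
    field_simp at this
    linarith
  have k3 : 4 - a ≤ u := by
    have := mul_le_mul_of_nonneg_left j3 (sq_nonneg a)
    field_simp at this
    nlinarith
  have k4 : a * (4 - a) < 3 := by
    have := (lt_div_iff₀ ha0).1 (k3.trans_lt hu)
    linarith
  have k5 : 3 < a := by nlinarith
  nlinarith

theorem exists_nonpos_value_of_laguerrePolyaI {f : ℂ → ℂ} {A : ℕ → ℝ} (hpos : ∀ k, 0 < A k)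
    (hf : ∀ z : ℂ, HasSum (fun k : ℕ => (A k : ℂ) * z ^ k) (f z))
    {a b : ℝ} (ha : 1 < a) (hab : a < b) (h2 : secondQuotient A 2 = a)
    (h3 : secondQuotient A 3 = b) (hLP : LaguerrePolyaI f) :
    ∃ z₀ : ℝ, z₀ ∈ Set.Icc (-(A 1 / A 2)) 0 ∧ f z₀ ≤ 0 := by
  obtain ⟨-, C, β, n, S, x, hβ, hx, hsum, hprod⟩ := hLP
  have hA0 := hpos 0
  have hA1 := hpos 1
  have hA2 := hpos 2
  have hA3 := hpos 3
  have hf0 : f 0 = A 0 := by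
    have := (hf 0).unique (hasSum_single 0 fun k hk => by simp [hk])
    simpa using this
  have hn : n = 0 := by
    by_contra hn
    have := hprod 0
    rw [hf0] at this
    simp [hn, hA0.ne'] at this
  subst hn
  have hC : C = A 0 := by
    have := hprod 0
    rw [hf0] at this
    simpa using this.symm
  subst hC
  set y : S → ℝ := fun k => 1 / x k with hy
  have hy0 : ∀ k, 0 ≤ y k := fun k => (one_div_pos.2 (hx k)).le
  have hG : ∀ t : ℝ, HasSum (fun k => A k / A 0 * t ^ k) ((f t).re / A 0) := fun t =>
    ((hasSum_re_of_hasSum_pow (hf t)).1.div_const (A 0)).congr_fun fun k => by ring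
  have hGprod : ∀ t : ℝ, (f t).re / A 0 = Real.exp (β * t) * ∏' k, (1 + y k * t) := by
    intro t
    have hmul : Multipliable fun k => 1 + y k * t :=
      Real.multipliable_one_add_of_summable (hsum.mul_right t)
    have hmap := hmul.map_tprod Complex.ofRealHom Complex.continuous_ofReal
    have : f t = ((A 0 * (Real.exp (β * t) * ∏' k, (1 + y k * t)) : ℝ) : ℂ) := by
      rw [hprod t, Complex.ofReal_mul, Complex.ofReal_mul]
      have hmap' : ((∏' k, (1 + y k * t) : ℝ) : ℂ) = ∏' k, (1 + (t : ℂ) / (x k : ℂ)) := by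
        refine hmap.trans (tprod_congr fun k => ?_)
        simp [hy, div_eq_mul_inv, mul_comm]
      rw [hmap']
      push_cast
      ring
    rw [this, Complex.ofReal_re]
    field_simp
  obtain ⟨p1, p2, p3⟩ := power_sums_of_eq_exp_mul_tprod hy0 hsum
    (fun k => (div_pos (hpos k) hA0).le) (div_self hA0.ne') hG hGprod
  have q2 : A 2 / A 0 = (A 1 / A 0) ^ 2 / a := by
    rw [← h2, secondQuotient]
    simp only [Nat.reduceSub]
    field_simp
  have q3 : A 3 / A 0 = (A 1 / A 0) ^ 3 / (a ^ 2 * b) := by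
    rw [← h2, ← h3, secondQuotient, secondQuotient]
    simp only [Nat.reduceSub]
    field_simp
  -- The threshold g/a is the reciprocal of the interval's length, so y_k > g/a places the zero -x_k
  -- inside the interval.
  have hM : A 1 / A 0 / a = A 2 / A 1 := by
    rw [← h2, secondQuotient]
    simp only [Nat.reduceSub]
    field_simp
  rw [q2] at p2 p3
  rw [q3] at p3
  obtain ⟨k, hk⟩ := exists_le_of_power_sums (g := A 1 / A 0) (by positivity) ha hab hy0 hsum
    (by linarith) (p2.trans (by ring)) (p3.trans (by ring))
  rw [hM] at hk
  have hxk := hx k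
  refine ⟨-x k, ⟨neg_le_neg ?_, by linarith⟩, ?_⟩
  · have := one_div_le_one_div_of_le (by positivity) hk.le
    simpa [hy] using this
  · rw [hprod, tprod_of_exists_eq_zero ⟨k, ?_⟩, mul_zero]
    have : (x k : ℂ) ≠ 0 := Complex.ofReal_ne_zero.2 hxk.ne'
    push_cast
    rw [neg_div, div_self this]
    ring

theorem theorem1 (f : ℂ → ℂ) (coeff : ℕ → ℝ) (hpos : ∀ k, 0 < coeff k)
    (hf : ∀ z : ℂ, HasSum (fun k : ℕ => (coeff k : ℂ) * z ^ k) (f z))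
    (a b : ℝ) (ha : 1 < a) (hab : a < b)
    (heven : ∀ m : ℕ, 1 ≤ m → secondQuotient coeff (2 * m) = a)
    (hodd : ∀ m : ℕ, 1 ≤ m → secondQuotient coeff (2 * m + 1) = b) :
    LaguerrePolyaI f ↔
      ∃ z₀ : ℝ, z₀ ∈ Set.Icc (-(coeff 1 / coeff 2)) 0 ∧ f (z₀ : ℂ) ≤ 0 := by
  refine ⟨exists_nonpos_value_of_laguerrePolyaI hpos hf ha hab (heven 1 le_rfl) (hodd 1 le_rfl), ?_⟩
  rintro ⟨z₀, hz₀, hfz⟩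
  exact laguerrePolyaI_of_nonpos_value hpos hf ha hab heven hodd hz₀ hfz
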